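/- For an integer $N\ge 1$ call a real sequence $\{a_n\}_{n=1}^N$ uniformly convex (with parameter $N$) if $a_{n+1}-a_n\in[\frac1{4N},\frac4N]$ for $1\le n\le N-1$ and $(a_{n+2}-a_{n+1})-(a_{n+1}-a_n)\in[\frac1{4N^2},\frac4{N^2}]$ for $1\le n\le N-2$. Write $e(x)=e^{2\pi i x}$ and $\|b\|_{\ell^2}=(\sum_{n=1}^N|b_n|^2)^{1/2}$. (i) There is a constant $c>0$ such that for every integer $N\ge 10$ there exists a uniformly convex sequence $\{a_n\}_{n=1}^N$ with $|\{a_n\}_{n=1}^N\cap N^{-1}\mathbb Z|\ge c\,N^{2/3}$. (ii) For every $c>0$ there is a constant $C>0$, depending only on $c$, such that the following holds. For every integer $N\ge 10$ and every uniformly convex sequence $\{a_n\}_{n=1}^N$ with $|\{a_n\}_{n=1}^N\cap N^{-1}\mathbb Z|\ge c\,N^{2/3}$, put $v_n=\left(\frac nN-\frac{a_n}N,\;a_n\right)\in\mathbb R^2$ for $1\le n\le N$. Then there is a complex sequence $\{b_n\}_{n=1}^N$, not identically zero, such that $$\Big\|\sup_{x\in[0,N^2]}\Big|\sum_{n=1}^N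 b_n\,e\big((x,t)\cdot v_n\big)\Big|\,\Big\|_{L^4_t([0,N^2])}\;\ge\; C\,N^{5/6}\,\|b\|_{\ell^2}.$$ -/

import Mathlib

/-- The sequence `a 1, …, a N` is uniformly convex with parameter `N`. Values of `a` outside
`{1, …, N}` play no role. -/
def UniformlyConvexSeq (N : ℕ) (a : ℕ → ℝ) : Prop :=
  (∀ n : ℕ, 1 ≤ n → n + 1 ≤ N →
    a (n + 1) - a n ∈ Set.Icc (1 / (4 * (N : ℝ))) (4 / (N : ℝ))) ∧
  (∀ n : ℕ, 1 ≤ n → n + 2 ≤ N →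
    (a (n + 2) - a (n + 1)) - (a (n + 1) - a n) ∈
      Set.Icc (1 / (4 * (N : ℝ) ^ 2)) (4 / (N : ℝ) ^ 2))

/-- The cardinality of `{a 1, …, a N} ∩ N⁻¹ℤ`. -/
noncomputable def latticeHits (N : ℕ) (a : ℕ → ℝ) : ℕ :=
  Set.ncard (a '' Set.Icc 1 N ∩ {y : ℝ | ∃ m : ℤ, y = (m : ℝ) / (N : ℝ)})

/-- The character `e(x) = exp(2πix)`. -/
noncomputable def eChar (x : ℝ) : ℂ :=
  Complex.exp (2 * (Real.pi : ℂ) * Complex.I * (x : ℂ))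

/-- The frequency `v_n = (n/N - a_n/N, a_n)`. -/
noncomputable def freq (N : ℕ) (a : ℕ → ℝ) (n : ℕ) : ℝ × ℝ :=
  ((n : ℝ) / (N : ℝ) - a n / (N : ℝ), a n)

/-- The exponential sum `∑_{n=1}^N b_n e((x,t) · v_n)`. -/
noncomputable def expSum (N : ℕ) (a : ℕ → ℝ) (b : ℕ → ℂ) (x t : ℝ) : ℂ :=
  ∑ n ∈ Finset.Icc 1 N, b n * eChar (x * (freq N a n).1 + t * (freq N a n).2)

/-- The maximal function `t ↦ sup_{x ∈ [0,N²]} |∑_{n=1}^N b_n e((x,t) · v_n)|`. -/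
noncomputable def maximalFn (N : ℕ) (a : ℕ → ℝ) (b : ℕ → ℂ) (t : ℝ) : ℝ :=
  ⨆ x : Set.Icc (0 : ℝ) ((N : ℝ) ^ 2), ‖expSum N a b (x : ℝ) t‖

/-- The `ℓ²` norm of `b 1, …, b N`. -/
noncomputable def l2Norm (N : ℕ) (b : ℕ → ℂ) : ℝ :=
  Real.sqrt (∑ n ∈ Finset.Icc 1 N, ‖b n‖ ^ 2)

/-! For (ii), take `b` to be the indicator of the set of hits, of size H. If t = j + τ with 0 ≤ τ <
1/40, the choice x = N(j mod N) turns every hit's phase into τ a_n modulo 1 (`eChar_freq_of_hit`).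
The a_n lie in an interval of length 4, so these phases are nearly aligned and the sum has size at
least H/2. Such t fill measure N²/40, so the L⁴ norm is ≳ H N^(1/2) = H^(1/2) N^(1/2) ‖b‖, and H ≥ c
N^(2/3) gives the exponent 5/6.

For (i), work with N a_n and seek integer values. Start from n + n²/(2N), with slope about 1 + p/q
near n = N p/q. For coprime p < q with q comparable to Q ~ N^(1/3), one of q consecutive values
there is within O(1/Q) of an integer (`exists_near_hit`). Distinct points N p/q are at least N/Q² ≳
Q apart, so each value can be corrected by its own bump of width ~ Q. This costs O(1/Q)/Q² ~ 1/N in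
second differences, with a constant small enough to preserve convexity (`perturbedSeq_second_diff`).
There are ≳ Q² ~ N^(2/3) such fractions (`sq_div_le_card_fareyPairs`). -/

section MaximalLowerBound

open MeasureTheory

/-! ### Lower bound for the maximal function -/

lemma eChar_add (x y : ℝ) : eChar (x + y) = eChar x * eChar y := by
  simp only [eChar, ← Complex.exp_add]
  congr 1
  push_cast
  ring

lemma eChar_intCast (k : ℤ) : eChar k = 1 := by
  rw [eChar, Complex.exp_eq_one_iff]
  exact ⟨k, by push_cast; ring⟩

lemma norm_eChar (x : ℝ) : ‖eChar x‖ = 1 := by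
  rw [eChar, Complex.norm_exp]
  simp

lemma re_eChar (x : ℝ) : (eChar x).re = Real.cos (2 * Real.pi * x) := by
  have h : eChar x = Complex.exp ((2 * Real.pi * x : ℝ) * Complex.I) := by
    rw [eChar]; congr 1; push_cast; ring
  rw [h, Complex.exp_ofReal_mul_I_re]

lemma half_le_re_eChar {x : ℝ} (h0 : 0 ≤ x) (h1 : x ≤ 1 / 10) : 1 / 2 ≤ (eChar x).re := by
  rw [re_eChar]
  have h := Real.one_sub_sq_div_two_le_cos (x := 2 * Real.pi * x)
  have hpi := Real.pi_lt_d2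
  have hpi0 := Real.pi_pos
  have h2 : 2 * Real.pi * x ≤ 1 := by nlinarith
  have h3 : 0 ≤ 2 * Real.pi * x := by positivity
  nlinarith

lemma UniformlyConvexSeq.add_div_le {N : ℕ} {a : ℕ → ℝ} (ha : UniformlyConvexSeq N a) (k : ℕ)
    {n : ℕ} (hn : 1 ≤ n) (hk : n + k ≤ N) :
    a n + k / (4 * (N : ℝ)) ≤ a (n + k) ∧ a (n + k) ≤ a n + 4 * k / (N : ℝ) := by
  induction k with
  | zero => simp
  | succ k ih =>
    obtain ⟨h1, h2⟩ := ih (by omega)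
    obtain ⟨h3, h4⟩ := ha.1 (n + k) (by omega) (by omega)
    rw [show n + (k + 1) = n + k + 1 by ring]
    push_cast
    constructor
    · rw [add_div]; linarith
    · rw [mul_add, add_div, mul_one]; linarith

lemma UniformlyConvexSeq.strictMonoOn {N : ℕ} {a : ℕ → ℝ} (ha : UniformlyConvexSeq N a) :
    StrictMonoOn a (Set.Icc 1 N) := by
  intro m hm n hn hmn
  have h := (ha.add_div_le (n - m) hm.1 (by have := hn.2; omega)).1
  rw [show m + (n - m) = n by omega] at h
  have hN : 0 < (N : ℝ) := by have := hn.2; exact_mod_cast (by omega : 0 < N)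
  have hk : 0 < ((n - m : ℕ) : ℝ) := by exact_mod_cast (by omega : 0 < n - m)
  have : 0 < ((n - m : ℕ) : ℝ) / (4 * (N : ℝ)) := by positivity
  linarith

open Classical in
/-- The indices `n ∈ {1, …, N}` with `a n ∈ N⁻¹ℤ`. -/
noncomputable def hitIndices (N : ℕ) (a : ℕ → ℝ) : Finset ℕ :=
  {n ∈ Finset.Icc 1 N | ∃ m : ℤ, a n = (m : ℝ) / (N : ℝ)}

lemma mem_hitIndices {N : ℕ} {a : ℕ → ℝ} {n : ℕ} :
    n ∈ hitIndices N a ↔ n ∈ Finset.Icc 1 N ∧ ∃ m : ℤ, a n = (m : ℝ) / (N : ℝ) := by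
  classical
  simp [hitIndices]

lemma UniformlyConvexSeq.latticeHits_eq {N : ℕ} {a : ℕ → ℝ} (ha : UniformlyConvexSeq N a) :
    latticeHits N a = (hitIndices N a).card := by
  have h : a '' Set.Icc 1 N ∩ {y : ℝ | ∃ m : ℤ, y = (m : ℝ) / (N : ℝ)}
      = a '' (hitIndices N a : Set ℕ) := by
    ext y
    simp only [Set.mem_inter_iff, Set.mem_image, Set.mem_ofPred_eq, Finset.mem_coe,
      mem_hitIndices, Finset.mem_Icc, Set.mem_Icc]
    constructor
    · rintro ⟨⟨n, hn, rfl⟩, hm⟩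
      exact ⟨n, ⟨hn, hm⟩, rfl⟩
    · rintro ⟨n, ⟨hn, hm⟩, rfl⟩
      exact ⟨⟨n, hn, rfl⟩, hm⟩
  rw [latticeHits, h, Set.InjOn.ncard_image, Set.ncard_coe_finset]
  refine ha.strictMonoOn.injOn.mono fun n hn => ?_
  exact Finset.mem_Icc.1 (mem_hitIndices.1 hn).1

lemma norm_expSum_le (N : ℕ) (a : ℕ → ℝ) (b : ℕ → ℂ) (x t : ℝ) :
    ‖expSum N a b x t‖ ≤ ∑ n ∈ Finset.Icc 1 N, ‖b n‖ := by
  refine (norm_sum_le _ _).trans (Finset.sum_le_sum fun n _ => ?_)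
  rw [norm_mul, norm_eChar, mul_one]

lemma norm_expSum_le_maximalFn (N : ℕ) (a : ℕ → ℝ) (b : ℕ → ℂ) {x : ℝ} (t : ℝ)
    (hx : x ∈ Set.Icc (0 : ℝ) ((N : ℝ) ^ 2)) : ‖expSum N a b x t‖ ≤ maximalFn N a b t := by
  refine le_ciSup (f := fun x : Set.Icc (0 : ℝ) ((N : ℝ) ^ 2) => ‖expSum N a b (x : ℝ) t‖)
    ⟨∑ n ∈ Finset.Icc 1 N, ‖b n‖, ?_⟩ ⟨x, hx⟩
  rintro _ ⟨y, rfl⟩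
  exact norm_expSum_le N a b y t

/-- The indicator sequence of the indices counted by `latticeHits`. -/
noncomputable def hitCoeff (N : ℕ) (a : ℕ → ℝ) : ℕ → ℂ :=
  (hitIndices N a : Set ℕ).indicator 1

lemma filter_mem_hitIndices (N : ℕ) (a : ℕ → ℝ) :
    (Finset.Icc 1 N).filter (· ∈ hitIndices N a) = hitIndices N a := by
  ext n
  rw [Finset.mem_filter]
  exact ⟨fun h => h.2, fun h => ⟨(mem_hitIndices.1 h).1, h⟩⟩

lemma l2Norm_hitCoeff (N : ℕ) (a : ℕ → ℝ) :
    l2Norm N (hitCoeff N a) = Real.sqrt (hitIndices N a).card := by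
  have h : ∀ n, ‖hitCoeff N a n‖ ^ 2 = if n ∈ hitIndices N a then 1 else 0 := by
    intro n
    by_cases hn : n ∈ hitIndices N a <;> simp [hitCoeff, hn]
  simp only [l2Norm, h]
  rw [← Finset.sum_filter, filter_mem_hitIndices]
  simp

lemma expSum_hitCoeff (N : ℕ) (a : ℕ → ℝ) (x t : ℝ) :
    expSum N a (hitCoeff N a) x t =
      ∑ n ∈ hitIndices N a, eChar (x * (freq N a n).1 + t * (freq N a n).2) := by
  rw [expSum, ← Finset.sum_subset (s₁ := hitIndices N a)]
  · refine Finset.sum_congr rfl fun n hn => ?_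
    simp [hitCoeff, hn]
  · intro n hn
    exact (mem_hitIndices.1 hn).1
  · intro n _ hn
    simp [hitCoeff, hn]

/-- On the lattice points, shifting `x` by `N k` undoes the integer part `k` of `t` modulo `N`. -/
lemma eChar_freq_of_hit {N : ℕ} (hN : N ≠ 0) {a : ℕ → ℝ} {n : ℕ} (hn : n ∈ hitIndices N a)
    (j : ℕ) (τ : ℝ) :
    eChar ((N : ℝ) * (j % N : ℕ) * (freq N a n).1 + (j + τ) * (freq N a n).2)
      = eChar (τ * a n) := by
  obtain ⟨-, m, hm⟩ := mem_hitIndices.1 hn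
  have hN' : (N : ℝ) ≠ 0 := by exact_mod_cast hN
  have hj : (j : ℝ) = N * (j / N : ℕ) + (j % N : ℕ) := by exact_mod_cast (Nat.div_add_mod j N).symm
  generalize j % N = v at hj ⊢
  generalize j / N = u at hj
  -- With j = N u + v and a_n = m/N, the terms v a_n cancel and N u a_n = u m is an integer.
  have : (N : ℝ) * v * (freq N a n).1 + (j + τ) * (freq N a n).2
      = (((v : ℤ) * n + (u : ℤ) * m : ℤ) : ℝ) + τ * a n := by
    simp only [freq]
    rw [hj, hm]
    push_cast
    field_simp
    ring
  rw [this, eChar_add, eChar_intCast, one_mul]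

/-- After factoring out the phase at a_1, the remaining phases lie in [0, 4τ] ⊆ [0, 1/10], where the
real part of the character is at least 1/2. -/
lemma half_card_le_norm_sum_eChar {N : ℕ} {a : ℕ → ℝ}
    (ha : UniformlyConvexSeq N a) {τ : ℝ} (h0 : 0 ≤ τ) (h1 : τ ≤ 1 / 40) :
    ((hitIndices N a).card : ℝ) / 2 ≤ ‖∑ n ∈ hitIndices N a, eChar (τ * a n)‖ := by
  have h : ∑ n ∈ hitIndices N a, eChar (τ * a n)
      = eChar (τ * a 1) * ∑ n ∈ hitIndices N a, eChar (τ * (a n - a 1)) := by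
    rw [Finset.mul_sum]
    refine Finset.sum_congr rfl fun n _ => ?_
    rw [← eChar_add]
    congr 1
    ring
  rw [h, norm_mul, norm_eChar, one_mul]
  refine le_trans ?_ (Complex.re_le_norm _)
  rw [Complex.re_sum, div_eq_mul_one_div, ← nsmul_eq_mul]
  refine Finset.card_nsmul_le_sum _ _ _ fun n hn => ?_
  obtain ⟨hn1, hn2⟩ := Finset.mem_Icc.1 (mem_hitIndices.1 hn).1
  have hb := ha.add_div_le (n - 1) le_rfl (by omega)
  rw [show 1 + (n - 1) = n by omega] at hb
  have hN : 0 < (N : ℝ) := by exact_mod_cast (by omega : 0 < N)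
  have hk : ((n - 1 : ℕ) : ℝ) ≤ N := by exact_mod_cast (by omega : n - 1 ≤ N)
  have h4 : 4 * ((n - 1 : ℕ) : ℝ) / (N : ℝ) ≤ 4 := by
    rw [div_le_iff₀ hN]; linarith
  have h5 : 0 ≤ ((n - 1 : ℕ) : ℝ) / (4 * (N : ℝ)) := by positivity
  have h6 : 0 ≤ a n - a 1 := by linarith [hb.1]
  have h7 : a n - a 1 ≤ 4 := by linarith [hb.2]
  apply half_le_re_eChar (by positivity)
  nlinarith

/-- The points of `[0, M)` with fractional part less than `δ`. -/
def smallFract (M : ℕ) (δ : ℝ) : Set ℝ :=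
  ⋃ j ∈ Finset.range M, Set.Ico (j : ℝ) (j + δ)

lemma measurableSet_smallFract (M : ℕ) (δ : ℝ) : MeasurableSet (smallFract M δ) :=
  Finset.measurableSet_biUnion _ fun _ _ => measurableSet_Ico

lemma volume_smallFract (M : ℕ) {δ : ℝ} (hδ : δ ≤ 1) :
    volume (smallFract M δ) = M * ENNReal.ofReal δ := by
  rw [smallFract, measure_biUnion_finset]
  · simp
  · intro i _ j _ hij
    refine Set.disjoint_left.2 fun x hx hy => hij ?_
    have h1 : (i : ℝ) < j + 1 := by linarith [hx.1, hy.2]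
    have h2 : (j : ℝ) < i + 1 := by linarith [hy.1, hx.2]
    have h3 : i < j + 1 := by exact_mod_cast h1
    have h4 : j < i + 1 := by exact_mod_cast h2
    omega
  · exact fun _ _ => measurableSet_Ico

lemma smallFract_subset (M : ℕ) {δ : ℝ} (hδ : δ ≤ 1) :
    smallFract M δ ⊆ Set.Icc (0 : ℝ) M := by
  intro x hx
  simp only [smallFract, Set.mem_iUnion, Finset.mem_range] at hx
  obtain ⟨j, hj, h1, h2⟩ := hx
  have h3 : (j : ℝ) + 1 ≤ M := by exact_mod_cast hj
  have h4 : (0 : ℝ) ≤ j := j.cast_nonneg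
  exact ⟨by linarith, by linarith⟩

lemma half_card_le_maximalFn {N : ℕ} (hN : N ≠ 0) {a : ℕ → ℝ} (ha : UniformlyConvexSeq N a)
    {M : ℕ} {t : ℝ} (ht : t ∈ smallFract M (1 / 40)) :
    ((hitIndices N a).card : ℝ) / 2 ≤ maximalFn N a (hitCoeff N a) t := by
  simp only [smallFract, Set.mem_iUnion, Finset.mem_range] at ht
  obtain ⟨j, -, h1, h2⟩ := ht
  have hx : (N : ℝ) * (j % N : ℕ) ∈ Set.Icc (0 : ℝ) ((N : ℝ) ^ 2) := by
    refine ⟨by positivity, ?_⟩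
    rw [sq]
    have : j % N ≤ N := (Nat.mod_lt _ (by omega)).le
    gcongr
  refine le_trans ?_ (norm_expSum_le_maximalFn N a (hitCoeff N a) t hx)
  rw [expSum_hitCoeff]
  obtain ⟨τ, rfl⟩ : ∃ τ, t = j + τ := ⟨t - j, by ring⟩
  rw [Finset.sum_congr rfl fun n hn => eChar_freq_of_hit hN hn j τ]
  exact half_card_le_norm_sum_eChar ha (by linarith) (by linarith)

lemma le_eLpNorm_maximalFn {N : ℕ} (hN : N ≠ 0) {a : ℕ → ℝ} (ha : UniformlyConvexSeq N a) :
    ENNReal.ofReal ((hitIndices N a).card / 2 * ((N : ℝ) ^ 2 / 40) ^ (1 / 4 : ℝ)) ≤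
      eLpNorm (maximalFn N a (hitCoeff N a)) 4
        (volume.restrict (Set.Icc (0 : ℝ) ((N : ℝ) ^ 2))) := by
  set E := smallFract (N ^ 2) (1 / 40) with hE
  have hsub : E ⊆ Set.Icc (0 : ℝ) ((N : ℝ) ^ 2) := by
    have := smallFract_subset (N ^ 2) (δ := 1 / 40) (by norm_num)
    rwa [Nat.cast_pow] at this
  have hmeas : MeasurableSet E := measurableSet_smallFract _ _
  have hmono : eLpNorm (E.indicator fun _ => ((hitIndices N a).card : ℝ) / 2) 4
      (volume.restrict (Set.Icc (0 : ℝ) ((N : ℝ) ^ 2))) ≤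
      eLpNorm (maximalFn N a (hitCoeff N a)) 4
        (volume.restrict (Set.Icc (0 : ℝ) ((N : ℝ) ^ 2))) := by
    refine eLpNorm_mono fun t => ?_
    by_cases ht : t ∈ E
    · rw [Set.indicator_of_mem ht, Real.norm_of_nonneg (by positivity)]
      exact (half_card_le_maximalFn hN ha ht).trans (le_abs_self _)
    · rw [Set.indicator_of_notMem ht, norm_zero]
      exact norm_nonneg _
  refine le_trans (le_of_eq ?_) hmono
  rw [eLpNorm_indicator_const hmeas (by norm_num) (by norm_num), Measure.restrict_apply hmeas,
    Set.inter_eq_self_of_subset_left hsub, hE, volume_smallFract _ (by norm_num),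
    Real.enorm_of_nonneg (by positivity), ENNReal.ofReal_mul (by positivity)]
  congr 1
  rw [← ENNReal.ofReal_natCast, ← ENNReal.ofReal_mul (by positivity),
    ENNReal.ofReal_rpow_of_nonneg (by positivity) (by positivity)]
  congr 1
  push_cast
  rw [mul_one_div]
  norm_num

theorem exists_coeff_le_eLpNorm_maximalFn {c : ℝ} (hc : 0 < c) {N : ℕ} (hN : 10 ≤ N) {a : ℕ → ℝ}
    (ha : UniformlyConvexSeq N a) (hhits : c * (N : ℝ) ^ (2 / 3 : ℝ) ≤ (latticeHits N a : ℝ)) :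
    ∃ b : ℕ → ℂ, (∃ n ∈ Finset.Icc 1 N, b n ≠ 0) ∧
      ENNReal.ofReal (Real.sqrt c / 2 * (1 / 40) ^ (1 / 4 : ℝ) *
          (N : ℝ) ^ (5 / 6 : ℝ) * l2Norm N b) ≤
        eLpNorm (maximalFn N a b) 4 (volume.restrict (Set.Icc (0 : ℝ) ((N : ℝ) ^ 2))) := by
  have hN0 : 0 < (N : ℝ) := by exact_mod_cast (by omega : 0 < N)
  rw [ha.latticeHits_eq] at hhits
  refine ⟨hitCoeff N a, ?_, le_trans (ENNReal.ofReal_le_ofReal ?_)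
    (le_eLpNorm_maximalFn (by omega) ha)⟩
  · have : 0 < ((hitIndices N a).card : ℝ) := lt_of_lt_of_le (by positivity) hhits
    obtain ⟨n, hn⟩ := Finset.card_pos.1 (by exact_mod_cast this)
    exact ⟨n, (mem_hitIndices.1 hn).1, by simp [hitCoeff, hn]⟩
  · rw [l2Norm_hitCoeff]
    set s : ℝ := ((hitIndices N a).card : ℝ)
    have hs : 0 ≤ s := Nat.cast_nonneg _
    have h1 : Real.sqrt c * (N : ℝ) ^ (1 / 3 : ℝ) ≤ Real.sqrt s := by
      refine le_trans (le_of_eq ?_) (Real.sqrt_le_sqrt hhits)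
      rw [Real.sqrt_mul hc.le, Real.sqrt_eq_rpow (_ ^ _), ← Real.rpow_mul hN0.le]
      norm_num
    have h2 : ((N : ℝ) ^ 2 / 40) ^ (1 / 4 : ℝ) = (1 / 40) ^ (1 / 4 : ℝ) * (N : ℝ) ^ (1 / 2 : ℝ) := by
      rw [div_eq_mul_one_div, Real.mul_rpow (by positivity) (by positivity), mul_comm,
        ← Real.rpow_natCast, ← Real.rpow_mul hN0.le]
      norm_num
    have h3 : (N : ℝ) ^ (5 / 6 : ℝ) = (N : ℝ) ^ (1 / 3 : ℝ) * (N : ℝ) ^ (1 / 2 : ℝ) := by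
      rw [← Real.rpow_add hN0]; norm_num
    rw [h2, h3]
    calc Real.sqrt c / 2 * (1 / 40) ^ (1 / 4 : ℝ) *
          ((N : ℝ) ^ (1 / 3 : ℝ) * (N : ℝ) ^ (1 / 2 : ℝ)) * Real.sqrt s
        = (Real.sqrt c * (N : ℝ) ^ (1 / 3 : ℝ)) *
          (Real.sqrt s / 2 * ((1 / 40) ^ (1 / 4 : ℝ) * (N : ℝ) ^ (1 / 2 : ℝ))) := by ring
      _ ≤ Real.sqrt s *
          (Real.sqrt s / 2 * ((1 / 40) ^ (1 / 4 : ℝ) * (N : ℝ) ^ (1 / 2 : ℝ))) := by gcongr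
      _ = _ := by
        rw [← mul_assoc, mul_div_assoc', Real.mul_self_sqrt hs]

end MaximalLowerBound

/-! ### A compactly supported bump with bounded second differences -/

/-- The truncated square, whose second differences lie in `[0, 2]`. -/
noncomputable def truncSq (x : ℝ) : ℝ := max 0 x ^ 2

lemma truncSq_of_nonneg {x : ℝ} (hx : 0 ≤ x) : truncSq x = x ^ 2 := by
  rw [truncSq, max_eq_right hx]

lemma truncSq_of_nonpos {x : ℝ} (hx : x ≤ 0) : truncSq x = 0 := by
  rw [truncSq, max_eq_left hx]; norm_num

lemma truncSq_second_diff (x : ℝ) :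
    truncSq (x + 2) - 2 * truncSq (x + 1) + truncSq x ∈ Set.Icc (0 : ℝ) 2 := by
  rcases le_total 0 x with h | h
  · rw [truncSq_of_nonneg h, truncSq_of_nonneg (by linarith : 0 ≤ x + 1),
      truncSq_of_nonneg (by linarith : 0 ≤ x + 2)]
    constructor <;> nlinarith
  rw [truncSq_of_nonpos h]
  rcases le_total 0 (x + 1) with h1 | h1
  · rw [truncSq_of_nonneg h1, truncSq_of_nonneg (by linarith : 0 ≤ x + 2)]
    constructor <;> nlinarith
  rw [truncSq_of_nonpos h1]
  rcases le_total 0 (x + 2) with h2 | h2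
  · rw [truncSq_of_nonneg h2]
    constructor <;> nlinarith
  · rw [truncSq_of_nonpos h2]
    norm_num

/-- The quadratic B-spline bump supported in `[-3L, 3L]`. -/
noncomputable def splineBump (L x : ℝ) : ℝ :=
  truncSq (x + 3 * L) - 3 * truncSq (x + L) + 3 * truncSq (x - L) - truncSq (x - 3 * L)

lemma splineBump_zero {L : ℝ} (hL : 0 ≤ L) : splineBump L 0 = 6 * L ^ 2 := by
  rw [splineBump, truncSq_of_nonneg (by linarith), truncSq_of_nonneg (by linarith),
    truncSq_of_nonpos (by linarith), truncSq_of_nonpos (by linarith)]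
  ring

/-- To the right of the support no square is truncated, and a third difference of a quadratic
vanishes; to the left every term is zero. -/
lemma splineBump_of_le_abs {L x : ℝ} (hL : 0 ≤ L) (hx : 3 * L ≤ |x|) : splineBump L x = 0 := by
  rcases le_abs.1 hx with h | h
  · rw [splineBump, truncSq_of_nonneg (by linarith), truncSq_of_nonneg (by linarith),
      truncSq_of_nonneg (by linarith), truncSq_of_nonneg (by linarith)]
    ring
  · rw [splineBump, truncSq_of_nonpos (by linarith), truncSq_of_nonpos (by linarith),
      truncSq_of_nonpos (by linarith), truncSq_of_nonpos (by linarith)]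
    ring

/-- The weights 1, -3, 3, -1 have positive and negative parts of total mass 4 each, multiplying
quantities in [0, 2]. The bound does not depend on `L`, while the peak is 6L². -/
lemma abs_splineBump_second_diff_le (L x : ℝ) :
    |splineBump L (x + 2) - 2 * splineBump L (x + 1) + splineBump L x| ≤ 8 := by
  have h1 := truncSq_second_diff (x + 3 * L)
  have h2 := truncSq_second_diff (x + L)
  have h3 := truncSq_second_diff (x - L)
  have h4 := truncSq_second_diff (x - 3 * L)
  simp only [splineBump, Set.mem_Icc] at *
  rw [show x + 2 + 3 * L = x + 3 * L + 2 by ring, show x + 1 + 3 * L = x + 3 * L + 1 by ring,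
    show x + 2 + L = x + L + 2 by ring, show x + 1 + L = x + L + 1 by ring,
    show x + 2 - L = x - L + 2 by ring, show x + 1 - L = x - L + 1 by ring,
    show x + 2 - 3 * L = x - 3 * L + 2 by ring, show x + 1 - 3 * L = x - 3 * L + 1 by ring]
  rw [abs_le]
  constructor <;> linarith

lemma splineBump_second_diff_eq_zero {L x : ℝ} (hL : 0 ≤ L) (hx : 3 * L + 1 ≤ |x + 1|) :
    splineBump L (x + 2) - 2 * splineBump L (x + 1) + splineBump L x = 0 := by
  rw [splineBump_of_le_abs hL (x := x + 2), splineBump_of_le_abs hL (x := x + 1),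
    splineBump_of_le_abs hL (x := x)]
  · norm_num
  · rcases le_abs.1 hx with h | h
    · exact le_abs.2 (Or.inl (by linarith))
    · exact le_abs.2 (Or.inr (by linarith))
  · linarith
  · rcases le_abs.1 hx with h | h
    · exact le_abs.2 (Or.inl (by linarith))
    · exact le_abs.2 (Or.inr (by linarith))

lemma abs_sum_le_of_at_most_one_ne_zero {ι : Type*} (s : Finset ι) (g : ι → ℝ) {M : ℝ} (hM : 0 ≤ M)
    (hg : ∀ i ∈ s, |g i| ≤ M)
    (hone : ∀ i ∈ s, ∀ j ∈ s, g i ≠ 0 → g j ≠ 0 → i = j) : |∑ i ∈ s, g i| ≤ M := by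
  by_cases h : ∃ i ∈ s, g i ≠ 0
  · obtain ⟨i, hi, hne⟩ := h
    rw [Finset.sum_eq_single_of_mem i hi]
    · exact hg i hi
    · intro j hj hji
      by_contra hj0
      exact hji (hone j hj i hi hj0 hne)
  · push Not at h
    rw [Finset.sum_eq_zero h, abs_zero]
    exact hM

/-! ### Perturbing the quadratic sequence -/

/-- The unperturbed sequence, with slopes in `[1, 2 + 1/N]` and second differences `1/N`. -/
noncomputable def baseSeq (N : ℕ) (n : ℕ) : ℝ := n + (n : ℝ) ^ 2 / (2 * N)

/-- The base sequence with its value at each `c ∈ T` moved to `m c`. -/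
noncomputable def perturbedSeq (N : ℕ) (L : ℝ) (T : Finset ℕ) (m : ℕ → ℤ) (n : ℕ) : ℝ :=
  baseSeq N n + ∑ c ∈ T, (m c - baseSeq N c) / (6 * L ^ 2) * splineBump L ((n : ℝ) - c)

section perturbedSeq

variable {N : ℕ} {L : ℝ} {T : Finset ℕ} {m : ℕ → ℤ}

lemma perturbedSeq_apply_mem (hL : 0 < L)
    (hsep : ∀ c ∈ T, ∀ d ∈ T, c ≠ d → 6 * L + 2 ≤ |(c : ℝ) - d|) {c : ℕ} (hc : c ∈ T) :
    perturbedSeq N L T m c = m c := by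
  rw [perturbedSeq, Finset.sum_eq_single_of_mem c hc]
  · rw [sub_self, splineBump_zero hL.le]
    field_simp
    ring
  · intro d hd hdc
    have := hsep c hc d hd hdc.symm
    rw [splineBump_of_le_abs hL.le (by linarith), mul_zero]

/-- The base contributes exactly 1/N. The separation 6L + 2 makes the supports of the bumps' second
differences disjoint, so at each `n` at most one correction enters, of size at most 1/(2N). -/
lemma perturbedSeq_second_diff (hN : 0 < N) (hL : 0 < L)
    (hsep : ∀ c ∈ T, ∀ d ∈ T, c ≠ d → 6 * L + 2 ≤ |(c : ℝ) - d|)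
    (herr : ∀ c ∈ T, |m c - baseSeq N c| / (6 * L ^ 2) * 8 ≤ 1 / (2 * N)) (n : ℕ) :
    (perturbedSeq N L T m (n + 2) - perturbedSeq N L T m (n + 1)) -
      (perturbedSeq N L T m (n + 1) - perturbedSeq N L T m n) ∈
      Set.Icc (1 / (2 * (N : ℝ))) (3 / (2 * N)) := by
  have hN' : 0 < (N : ℝ) := by exact_mod_cast hN
  have key := abs_sum_le_of_at_most_one_ne_zero T
    (fun c => (m c - baseSeq N c) / (6 * L ^ 2) *
      (splineBump L ((n : ℝ) - c + 2) - 2 * splineBump L ((n : ℝ) - c + 1)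
        + splineBump L ((n : ℝ) - c))) (M := 1 / (2 * N)) (by positivity) ?_ ?_
  · have hexp : (perturbedSeq N L T m (n + 2) - perturbedSeq N L T m (n + 1)) -
        (perturbedSeq N L T m (n + 1) - perturbedSeq N L T m n) = 1 / N +
        ∑ c ∈ T, (m c - baseSeq N c) / (6 * L ^ 2) *
          (splineBump L ((n : ℝ) - c + 2) - 2 * splineBump L ((n : ℝ) - c + 1)
            + splineBump L ((n : ℝ) - c)) := by
      have hb : baseSeq N (n + 2) - 2 * baseSeq N (n + 1) + baseSeq N n = 1 / N := by
        simp only [baseSeq]; push_cast; field_simp; ring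
      have hs : ∑ c ∈ T, (m c - baseSeq N c) / (6 * L ^ 2) *
          (splineBump L ((n : ℝ) - c + 2) - 2 * splineBump L ((n : ℝ) - c + 1)
            + splineBump L ((n : ℝ) - c)) =
          ∑ c ∈ T, (m c - baseSeq N c) / (6 * L ^ 2) * splineBump L (((n + 2 : ℕ) : ℝ) - c)
          - 2 * ∑ c ∈ T, (m c - baseSeq N c) / (6 * L ^ 2) * splineBump L (((n + 1 : ℕ) : ℝ) - c)
          + ∑ c ∈ T, (m c - baseSeq N c) / (6 * L ^ 2) * splineBump L ((n : ℝ) - c) := by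
        rw [Finset.mul_sum, ← Finset.sum_sub_distrib, ← Finset.sum_add_distrib]
        refine Finset.sum_congr rfl fun c _ => ?_
        push_cast
        rw [show (n : ℝ) + 2 - c = n - c + 2 by ring, show (n : ℝ) + 1 - c = n - c + 1 by ring]
        ring
      rw [hs, ← hb]
      simp only [perturbedSeq]
      ring
    rw [hexp]
    have h1 : 1 / (N : ℝ) = 1 / (2 * N) + 1 / (2 * N) := by field_simp; norm_num
    have h3 : 3 / (2 * (N : ℝ)) = 1 / (2 * N) + 1 / (2 * N) + 1 / (2 * N) := by
      field_simp; norm_num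
    rw [abs_le] at key
    constructor <;> linarith [key.1, key.2]
  · intro c hc
    rw [abs_mul, abs_div, abs_of_pos (by positivity : 0 < 6 * L ^ 2)]
    refine le_trans ?_ (herr c hc)
    gcongr
    exact abs_splineBump_second_diff_le _ _
  · intro c hc d hd hc0 hd0
    by_contra hcd
    have h := hsep c hc d hd hcd
    have hc1 : |(n : ℝ) - c + 1| < 3 * L + 1 := by
      by_contra hcon
      exact hc0 (by
        simp only [splineBump_second_diff_eq_zero hL.le (not_lt.1 hcon), mul_zero])
    have hd1 : |(n : ℝ) - d + 1| < 3 * L + 1 := by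
      by_contra hcon
      exact hd0 (by
        simp only [splineBump_second_diff_eq_zero hL.le (not_lt.1 hcon), mul_zero])
    rw [abs_lt] at hc1 hd1
    rcases le_abs.1 h with h | h <;> linarith [hc1.1, hc1.2, hd1.1, hd1.2]

lemma perturbedSeq_eq_baseSeq (hL : 0 < L) {n : ℕ}
    (hT : ∀ c ∈ T, 3 * L + n ≤ c) : perturbedSeq N L T m n = baseSeq N n := by
  rw [perturbedSeq, Finset.sum_eq_zero, add_zero]
  intro c hc
  have := hT c hc
  rw [splineBump_of_le_abs hL.le, mul_zero]
  exact le_abs.2 (Or.inr (by linarith))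

/-- Second differences are summed from n = 0; keeping the centres at least 3L + 2 from the origin
leaves the initial slope equal to that of the base. -/
lemma perturbedSeq_diff (hN : 0 < N) (hL : 0 < L)
    (hsep : ∀ c ∈ T, ∀ d ∈ T, c ≠ d → 6 * L + 2 ≤ |(c : ℝ) - d|)
    (herr : ∀ c ∈ T, |m c - baseSeq N c| / (6 * L ^ 2) * 8 ≤ 1 / (2 * N))
    (hT : ∀ c ∈ T, 3 * L + 2 ≤ c) (n : ℕ) :
    perturbedSeq N L T m (n + 1) - perturbedSeq N L T m n ∈
      Set.Icc (1 : ℝ) (1 + (3 * n + 1) / (2 * N)) := by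
  have hN' : 0 < (N : ℝ) := by exact_mod_cast hN
  induction n with
  | zero =>
    rw [perturbedSeq_eq_baseSeq hL fun c hc => ?_, perturbedSeq_eq_baseSeq hL fun c hc => ?_]
    · have : (0 : ℝ) ≤ 1 / (2 * N) := by positivity
      simp only [baseSeq]
      norm_num
    · have := hT c hc; push_cast; linarith
    · have := hT c hc; push_cast; linarith
  | succ n ih =>
    have h := perturbedSeq_second_diff hN hL hsep herr n
    have h0 : 0 ≤ 1 / (2 * (N : ℝ)) := by positivity
    have h1 : (3 * ((n + 1 : ℕ) : ℝ) + 1) / (2 * N)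
        = (3 * (n : ℝ) + 1) / (2 * N) + 3 / (2 * N) := by
      push_cast; ring
    rw [Set.mem_Icc] at *
    rw [h1]
    constructor <;> linarith [h.1, h.2, ih.1, ih.2]

theorem uniformlyConvexSeq_perturbedSeq (hN : 0 < N) (hL : 0 < L)
    (hsep : ∀ c ∈ T, ∀ d ∈ T, c ≠ d → 6 * L + 2 ≤ |(c : ℝ) - d|)
    (herr : ∀ c ∈ T, |m c - baseSeq N c| / (6 * L ^ 2) * 8 ≤ 1 / (2 * N))
    (hT : ∀ c ∈ T, 3 * L + 2 ≤ c) :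
    UniformlyConvexSeq N fun n => perturbedSeq N L T m n / N := by
  have hN' : 0 < (N : ℝ) := by exact_mod_cast hN
  constructor
  · intro n hn hnN
    obtain ⟨h1, h2⟩ := perturbedSeq_diff hN hL hsep herr hT n
    have h3 : (3 * (n : ℝ) + 1) / (2 * N) ≤ 3 := by
      rw [div_le_iff₀ (by positivity)]
      have : (n : ℝ) + 1 ≤ N := by exact_mod_cast hnN
      linarith
    rw [← sub_div, ← div_div]
    constructor
    · gcongr; linarith
    · gcongr; linarith
  · intro n hn hnN
    obtain ⟨h1, h2⟩ := perturbedSeq_second_diff hN hL hsep herr n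
    rw [← sub_div, ← sub_div, ← sub_div]
    constructor
    · calc 1 / (4 * (N : ℝ) ^ 2) ≤ 1 / (2 * (N : ℝ)) / N := by
            rw [div_div, div_le_div_iff₀ (by positivity) (by positivity)]
            nlinarith [sq_nonneg (N : ℝ)]
        _ ≤ _ := by gcongr
    · calc _ ≤ 3 / (2 * (N : ℝ)) / N := by gcongr
        _ ≤ 4 / (N : ℝ) ^ 2 := by
            rw [div_div, div_le_div_iff₀ (by positivity) (by positivity)]
            nlinarith [sq_nonneg (N : ℝ)]

end perturbedSeq

/-! ### Approximation modulo 1 and counting coprime pairs -/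

/-- For coprime `p, q`, the numbers `y + h p / q` with `0 ≤ h < q` come within `1/q` above an
integer. -/
lemma exists_lt_add_mul_div_near_int {p q : ℕ} (hq : 0 < q) (hpq : p.Coprime q) (y : ℝ) :
    ∃ h < q, ∃ m : ℤ, y + h * ((p : ℝ) / q) - m ∈ Set.Icc (0 : ℝ) (1 / q) := by
  have hq' : (0 : ℝ) < q := by exact_mod_cast hq
  have : NeZero q := ⟨hq.ne'⟩
  set k : ℤ := ⌊(q : ℝ) * y⌋
  set u := ZMod.unitOfCoprime p hpq
  -- Solves h p ≡ -⌊q y⌋ mod q, leaving only the fractional part of q y, divided by q.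
  set h : ℕ := (-(k : ZMod q) * (u⁻¹ : (ZMod q)ˣ)).val
  have hz : (((h : ℤ) * p + k : ℤ) : ZMod q) = 0 := by
    push_cast
    rw [ZMod.natCast_zmod_val, ← ZMod.coe_unitOfCoprime p hpq, mul_assoc, Units.inv_mul]
    ring
  obtain ⟨m, hm⟩ := (ZMod.intCast_zmod_eq_zero_iff_dvd _ q).1 hz
  refine ⟨h, ZMod.val_lt _, m, ?_⟩
  have hm' : (h : ℝ) * p + k = q * m := by exact_mod_cast hm
  have h1 : (k : ℝ) ≤ q * y := Int.floor_le _
  have h2 : (q : ℝ) * y < k + 1 := Int.lt_floor_add_one _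
  have h3 : y + h * ((p : ℝ) / q) - m = (q * y - k) / q := by
    field_simp
    linarith
  rw [h3]
  constructor
  · apply div_nonneg <;> linarith
  · gcongr; linarith

/-- Telescoping, from (2k + 3)² ≥ 4(k + 1)(k + 2). -/
lemma sum_inv_odd_sq_le (n : ℕ) :
    ∑ k ∈ Finset.range n, 1 / ((2 * (k : ℝ) + 3) ^ 2) ≤ 1 / 4 - 1 / (4 * ((n : ℝ) + 1)) := by
  induction n with
  | zero => simp
  | succ n ih =>
    rw [Finset.sum_range_succ]
    have h : 1 / ((2 * (n : ℝ) + 3) ^ 2) ≤ 1 / (4 * ((n : ℝ) + 1)) - 1 / (4 * ((n : ℝ) + 2)) := by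
      rw [div_sub_div _ _ (by positivity) (by positivity), div_le_div_iff₀ (by positivity)
        (by positivity)]
      nlinarith
    push_cast
    rw [show (n : ℝ) + 1 + 1 = n + 2 by ring]
    linarith

lemma card_pairs_dvd_le (Q d : ℕ) :
    ((((Finset.Ioc 0 Q ×ˢ Finset.Ioc 0 Q).filter fun x => d ∣ x.1 ∧ d ∣ x.2).card : ℕ) : ℝ)
      ≤ (Q : ℝ) ^ 2 * (1 / (d : ℝ) ^ 2) := by
  rw [Finset.filter_product (fun x => d ∣ x) (fun x => d ∣ x), Finset.card_product,
    Nat.Ioc_filter_dvd_card_eq_div]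
  push_cast
  have h : ((Q / d : ℕ) : ℝ) ≤ Q / d := Nat.cast_div_le
  calc ((Q / d : ℕ) : ℝ) * (Q / d : ℕ) ≤ (Q / d : ℝ) * (Q / d) := by gcongr
    _ = _ := by ring

/-- A non-coprime pair shares the factor 2 or an odd factor d ≥ 3. Each of these two cases covers at
most a quarter of the square. -/
lemma half_sq_le_card_coprime_pairs (Q : ℕ) :
    (Q : ℝ) ^ 2 / 2 ≤
      (((Finset.Ioc 0 Q ×ˢ Finset.Ioc 0 Q).filter fun x => x.1.Coprime x.2).card : ℝ) := by
  classical
  set S := Finset.Ioc 0 Q ×ˢ Finset.Ioc 0 Q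
  have hS : (S.card : ℝ) = (Q : ℝ) ^ 2 := by simp [S, sq]
  have hsum := Finset.card_filter_add_card_filter_not (s := S) (fun x => x.1.Coprime x.2)
  have hcover : S.filter (fun x => ¬ x.1.Coprime x.2) ⊆
      S.filter (fun x => 2 ∣ x.1 ∧ 2 ∣ x.2) ∪
        (Finset.range Q).biUnion fun k => S.filter fun x => 2 * k + 3 ∣ x.1 ∧ 2 * k + 3 ∣ x.2 := by
    intro x hx
    rw [Finset.mem_filter] at hx
    obtain ⟨hxS, hx⟩ := hx
    obtain ⟨d, hd, h1, h2⟩ := Nat.Prime.not_coprime_iff_dvd.1 hx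
    rw [Finset.mem_union, Finset.mem_biUnion]
    rcases hd.eq_two_or_odd' with rfl | ⟨k, rfl⟩
    · exact Or.inl (Finset.mem_filter.2 ⟨hxS, h1, h2⟩)
    · right
      have hk : k ≠ 0 := by rintro rfl; exact hd.ne_one rfl
      have hx1 := Finset.mem_Ioc.1 (Finset.mem_product.1 hxS).1
      have hle := Nat.le_of_dvd hx1.1 h1
      refine ⟨k - 1, Finset.mem_range.2 (by omega), Finset.mem_filter.2 ⟨hxS, ?_⟩⟩
      rw [show 2 * (k - 1) + 3 = 2 * k + 1 by omega]
      exact ⟨h1, h2⟩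
  have hle : ((S.filter fun x => ¬ x.1.Coprime x.2).card : ℝ) ≤ (Q : ℝ) ^ 2 / 2 := by
    calc ((S.filter fun x => ¬ x.1.Coprime x.2).card : ℝ)
        ≤ ((S.filter fun x => 2 ∣ x.1 ∧ 2 ∣ x.2).card : ℝ) +
          ∑ k ∈ Finset.range Q,
            ((S.filter fun x => 2 * k + 3 ∣ x.1 ∧ 2 * k + 3 ∣ x.2).card : ℝ) := by
          exact_mod_cast (Finset.card_le_card hcover).trans
            ((Finset.card_union_le _ _).trans (Nat.add_le_add_left Finset.card_biUnion_le _))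
      _ ≤ (Q : ℝ) ^ 2 * (1 / ((2 : ℕ) : ℝ) ^ 2) +
          ∑ k ∈ Finset.range Q, (Q : ℝ) ^ 2 * (1 / ((2 * k + 3 : ℕ) : ℝ) ^ 2) := by
          gcongr
          · exact card_pairs_dvd_le Q 2
          · exact card_pairs_dvd_le Q _
      _ ≤ (Q : ℝ) ^ 2 * (1 / 4) + (Q : ℝ) ^ 2 * (1 / 4) := by
          rw [← Finset.mul_sum]
          have h := sum_inv_odd_sq_le Q
          have h0 : (0 : ℝ) ≤ 1 / (4 * ((Q : ℝ) + 1)) := by positivity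
          push_cast
          gcongr
          · norm_num
          · linarith
      _ = _ := by ring
  have hsum' : ((S.filter fun x => x.1.Coprime x.2).card : ℝ) +
      ((S.filter fun x => ¬ x.1.Coprime x.2).card : ℝ) = S.card := by exact_mod_cast hsum
  linarith

/-- The coprime pairs `(p, q)` with `0 < p < q` and `Q / 4 < q ≤ Q`. -/
def fareyPairs (Q : ℕ) : Finset (ℕ × ℕ) :=
  (Finset.Ioc 0 Q ×ˢ Finset.Ioc 0 Q).filter
    fun x => x.1.Coprime x.2 ∧ x.1 < x.2 ∧ Q < 4 * x.2

/-- Up to swapping and the pair (1, 1), a coprime pair is a Farey pair or lies in the square of side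
Q/4. This leaves 3Q²/16 - 1/2, which suffices once Q ≥ 2. -/
lemma sq_div_le_card_fareyPairs {Q : ℕ} (hQ : 2 ≤ Q) :
    (Q : ℝ) ^ 2 / 16 ≤ ((fareyPairs Q).card : ℝ) := by
  classical
  set R := (Finset.Ioc 0 (Q / 4) ×ˢ Finset.Ioc 0 (Q / 4))
  set A := fareyPairs Q ∪ R
  have hcover : (Finset.Ioc 0 Q ×ˢ Finset.Ioc 0 Q).filter (fun x => x.1.Coprime x.2) ⊆
      (A ∪ A.image Prod.swap) ∪ {(1, 1)} := by
    rintro ⟨p, q⟩ hx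
    simp only [Finset.mem_filter, Finset.mem_product, Finset.mem_Ioc] at hx
    obtain ⟨⟨⟨hp, hpQ⟩, hq, hqQ⟩, hpq⟩ := hx
    simp only [A, R, fareyPairs, Finset.mem_union, Finset.mem_image, Finset.mem_filter,
      Finset.mem_product, Finset.mem_Ioc, Finset.mem_singleton, Prod.exists, Prod.mk.injEq,
      Prod.swap_prod_mk]
    rcases lt_trichotomy p q with h | h | h
    · left; left
      by_cases h4 : Q < 4 * q
      · left; exact ⟨⟨⟨hp, hpQ⟩, hq, hqQ⟩, hpq, h, h4⟩
      · right; omega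
    · subst h
      rw [Nat.coprime_self] at hpq
      right; exact ⟨hpq, hpq⟩
    · left; right
      refine ⟨q, p, ?_, rfl, rfl⟩
      by_cases h4 : Q < 4 * p
      · left; exact ⟨⟨⟨hq, hqQ⟩, hp, hpQ⟩, hpq.symm, h, h4⟩
      · right; omega
  have h1 := half_sq_le_card_coprime_pairs Q
  have h2 : ((Finset.Ioc 0 Q ×ˢ Finset.Ioc 0 Q).filter fun x => x.1.Coprime x.2).card
      ≤ 2 * A.card + 1 := by
    refine (Finset.card_le_card hcover).trans ((Finset.card_union_le _ _).trans ?_)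
    have h3 := Finset.card_union_le A (A.image Prod.swap)
    have h4 : (A.image Prod.swap).card ≤ A.card := Finset.card_image_le
    rw [Finset.card_singleton]
    omega
  have h3 : A.card ≤ (fareyPairs Q).card + (Q / 4) * (Q / 4) := by
    refine (Finset.card_union_le _ _).trans (le_of_eq ?_)
    simp [R]
  have h2' : (((Finset.Ioc 0 Q ×ˢ Finset.Ioc 0 Q).filter fun x => x.1.Coprime x.2).card : ℝ)
      ≤ 2 * A.card + 1 := by exact_mod_cast h2
  have h3' : (A.card : ℝ) ≤ (fareyPairs Q).card + ((Q / 4 : ℕ) : ℝ) * ((Q / 4 : ℕ) : ℝ) := by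
    exact_mod_cast h3
  have h4 : ((Q / 4 : ℕ) : ℝ) ≤ Q / 4 := by
    have := @Nat.cast_div_le ℝ _ _ _ Q 4; exact_mod_cast this
  have h5 : ((Q / 4 : ℕ) : ℝ) * ((Q / 4 : ℕ) : ℝ) ≤ (Q / 4 : ℝ) * (Q / 4) := by gcongr
  have h6 : (2 : ℝ) ≤ Q := by exact_mod_cast hQ
  nlinarith

/-! ### Near hits at Farey fractions and the construction -/

/-- Near `N p / q` the base sequence takes a value within `5 / Q` of an integer. -/
lemma exists_near_hit {N Q : ℕ} (hQN : 7000 * Q ^ 3 ≤ N) {p q : ℕ} (hpq : (p, q) ∈ fareyPairs Q) :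
    ∃ c : ℕ, (N : ℝ) * (p / q) - 1 ≤ c ∧ (c : ℝ) ≤ N * (p / q) + Q - 1 ∧ c ∈ Finset.Icc 1 N ∧
      ∃ m : ℤ, |m - baseSeq N c| ≤ 5 / Q := by
  simp only [fareyPairs, Finset.mem_filter, Finset.mem_product, Finset.mem_Ioc] at hpq
  obtain ⟨⟨⟨hp, -⟩, hq, hqQ⟩, hcop, hlt, h4⟩ := hpq
  have hp' : (1 : ℝ) ≤ p := by exact_mod_cast hp
  have hq' : (1 : ℝ) ≤ q := by exact_mod_cast hq
  have hqQ' : (q : ℝ) ≤ Q := by exact_mod_cast hqQ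
  have hlt' : (p : ℝ) + 1 ≤ q := by exact_mod_cast hlt
  have h4' : (Q : ℝ) ≤ 4 * q := by exact_mod_cast h4.le
  have hQN' : 7000 * (Q : ℝ) ^ 3 ≤ N := by exact_mod_cast hQN
  have hQ0 : (1 : ℝ) ≤ Q := hq'.trans hqQ'
  have hqN : (q : ℝ) ^ 2 ≤ N := by
    calc (q : ℝ) ^ 2 ≤ (Q : ℝ) ^ 2 * 1 := by rw [mul_one]; gcongr
      _ ≤ (Q : ℝ) ^ 2 * (7000 * Q) := by gcongr; linarith
      _ = 7000 * (Q : ℝ) ^ 3 := by ring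
      _ ≤ N := hQN'
  have hN0 : (0 : ℝ) < N := lt_of_lt_of_le (by positivity) hqN
  set x : ℝ := N * (p / q) with hx
  have hx0 : 0 ≤ x := by positivity
  set n : ℕ := ⌊x⌋₊
  have hn1 : (n : ℝ) ≤ x := Nat.floor_le hx0
  have hn2 : x < n + 1 := Nat.lt_floor_add_one x
  obtain ⟨h, hhq, m, hm⟩ := exists_lt_add_mul_div_near_int hq hcop (baseSeq N n)
  have hhq' : (h : ℝ) + 1 ≤ q := by exact_mod_cast hhq
  have hh0 : (0 : ℝ) ≤ h := h.cast_nonneg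
  have hxN : x + q ≤ N := by
    have h1 : x = N - N * ((q - p) / q) := by rw [hx]; field_simp; ring
    have h2 : (q : ℝ) ≤ N * ((q - p) / q) := by
      rw [mul_div_assoc', le_div_iff₀ (by positivity)]
      nlinarith
    linarith
  have hqx : (q : ℝ) ≤ x := by
    rw [hx, mul_div_assoc', le_div_iff₀ (by positivity)]
    nlinarith
  refine ⟨n + h, by push_cast; linarith, by push_cast; linarith, ?_, m + h, ?_⟩
  · rw [Finset.mem_Icc]
    constructor
    · have : (0 : ℝ) < n + h := by
        rcases Nat.eq_zero_or_pos n with h0 | h0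
        · exfalso
          have hn0 : (n : ℝ) = 0 := by exact_mod_cast h0
          have : (2 : ℝ) ≤ q := by linarith
          linarith
        · have : (0 : ℝ) < n := by exact_mod_cast h0
          linarith
      exact_mod_cast this
    · have : ((n + h : ℕ) : ℝ) ≤ N := by push_cast; linarith
      exact_mod_cast this
  · have hexp : baseSeq N (n + h) = baseSeq N n + h * ((p : ℝ) / q) + h +
        (h * (n - x) / N + (h : ℝ) ^ 2 / (2 * N)) := by
      simp only [baseSeq, hx]
      push_cast
      field_simp
      ring
    have h1 : 1 / (q : ℝ) ≤ 4 / Q := by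
      rw [div_le_div_iff₀ (by positivity) (by positivity)]; linarith
    have hQ2N : (Q : ℝ) ^ 2 / N ≤ 1 / Q := by
      rw [div_le_div_iff₀ hN0 (by positivity)]
      have : 0 ≤ (Q : ℝ) ^ 3 := by positivity
      nlinarith
    have hhQ : (h : ℝ) ≤ Q := by linarith
    have h2 : (h : ℝ) ^ 2 / (2 * N) ≤ 1 / Q := by
      refine le_trans ?_ hQ2N
      gcongr
      linarith
    have h3 : -(1 / (Q : ℝ)) ≤ h * (n - x) / N := by
      have : -((Q : ℝ) ^ 2 / N) ≤ h * (n - x) / N := by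
        rw [← neg_div]
        gcongr
        nlinarith
      linarith
    have h4 : h * (n - x) / N ≤ 0 :=
      div_nonpos_of_nonpos_of_nonneg (mul_nonpos_of_nonneg_of_nonpos hh0 (by linarith)) hN0.le
    have h5 : 0 ≤ (h : ℝ) ^ 2 / (2 * N) := by positivity
    have h6 : 5 / (Q : ℝ) = 4 / Q + 1 / Q := by ring
    have h7 : 0 < 1 / (Q : ℝ) := by positivity
    have h8 : 4 / (Q : ℝ) = 4 * (1 / Q) := by ring
    rw [hexp, abs_le]
    push_cast
    constructor <;> linarith [hm.1, hm.2]

/-- Distinct reduced fractions differ by at least 1/(q q') ≥ 1/Q². -/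
lemma le_abs_sub_of_mem_fareyPairs {N Q : ℕ} (hQN : 7000 * Q ^ 3 ≤ N) {p q p' q' : ℕ}
    (h : (p, q) ∈ fareyPairs Q) (h' : (p', q') ∈ fareyPairs Q) (hne : (p, q) ≠ (p', q')) :
    7000 * (Q : ℝ) ≤ |(N : ℝ) * (p / q) - N * (p' / q')| := by
  simp only [fareyPairs, Finset.mem_filter, Finset.mem_product, Finset.mem_Ioc] at h h'
  obtain ⟨⟨-, hq, hqQ⟩, hcop, -⟩ := h
  obtain ⟨⟨-, hq', hqQ'⟩, hcop', -⟩ := h'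
  have hcross : (p : ℤ) * q' - p' * q ≠ 0 := by
    intro h0
    have h1 : p * q' = p' * q := by
      have : (p : ℤ) * q' = p' * q := by linarith
      exact_mod_cast this
    have h2 : q ∣ q' := hcop.symm.dvd_of_dvd_mul_left (h1 ▸ Dvd.intro_left p' rfl)
    have h3 : q' ∣ q := hcop'.symm.dvd_of_dvd_mul_left (h1 ▸ Dvd.intro_left p rfl)
    obtain rfl := Nat.dvd_antisymm h2 h3
    exact hne (by rw [Nat.eq_of_mul_eq_mul_right hq h1])
  have h1 : (1 : ℝ) ≤ |(p : ℝ) * q' - p' * q| := by exact_mod_cast Int.one_le_abs hcross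
  have hq0 : (0 : ℝ) < q := by exact_mod_cast hq
  have hq0' : (0 : ℝ) < q' := by exact_mod_cast hq'
  have hqQ1 : (q : ℝ) ≤ Q := by exact_mod_cast hqQ
  have hqQ2 : (q' : ℝ) ≤ Q := by exact_mod_cast hqQ'
  have hQ0 : (0 : ℝ) < Q := hq0.trans_le hqQ1
  have hQN' : 7000 * (Q : ℝ) ^ 3 ≤ N := by exact_mod_cast hQN
  have hN : (0 : ℝ) ≤ N := N.cast_nonneg
  have h2 : (N : ℝ) * (p / q) - N * (p' / q') = N * ((p : ℝ) * q' - p' * q) / (q * q') := by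
    field_simp
  rw [h2, abs_div, abs_mul, abs_of_nonneg hN, abs_of_pos (by positivity : 0 < (q : ℝ) * q'),
    le_div_iff₀ (by positivity)]
  calc 7000 * (Q : ℝ) * (q * q') ≤ 7000 * (Q : ℝ) * (Q * Q) := by gcongr
    _ = 7000 * (Q : ℝ) ^ 3 := by ring
    _ ≤ N * 1 := by linarith
    _ ≤ _ := by gcongr

/-- Bumps with L = 1000Q fit: the separation 7000Q, less a shift of at most Q, exceeds 6L + 2. The
upper bound on `N` makes the corrections small enough for convexity. -/
lemma exists_uniformlyConvexSeq_card_fareyPairs_le {N Q : ℕ} (hQ : 1 ≤ Q)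
    (hQN : 7000 * Q ^ 3 ≤ N) (hNQ : N ≤ 56000 * Q ^ 3) :
    ∃ a : ℕ → ℝ, UniformlyConvexSeq N a ∧ (fareyPairs Q).card ≤ latticeHits N a := by
  classical
  have hQ1 : (1 : ℝ) ≤ Q := by exact_mod_cast hQ
  have hQN' : 7000 * (Q : ℝ) ^ 3 ≤ N := by exact_mod_cast hQN
  have hNQ' : (N : ℝ) ≤ 56000 * (Q : ℝ) ^ 3 := by exact_mod_cast hNQ
  have hN0 : (0 : ℝ) < N := lt_of_lt_of_le (by positivity) hQN'
  have hN : 0 < N := by exact_mod_cast hN0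
  have hex : ∀ x ∈ fareyPairs Q, ∃ c : ℕ, (N : ℝ) * (x.1 / x.2) - 1 ≤ c ∧
      (c : ℝ) ≤ N * (x.1 / x.2) + Q - 1 ∧ c ∈ Finset.Icc 1 N ∧
      ∃ m : ℤ, |m - baseSeq N c| ≤ 5 / Q := fun x hx => exists_near_hit hQN hx
  choose! c hc1 hc2 hc3 hc4 using hex
  have hdist : ∀ x ∈ fareyPairs Q, ∀ y ∈ fareyPairs Q, x ≠ y →
      6 * (1000 * (Q : ℝ)) + 2 ≤ |(c x : ℝ) - c y| := by
    intro x hx y hy hxy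
    have h := le_abs_sub_of_mem_fareyPairs hQN hx hy hxy
    have hx1 := hc1 x hx
    have hx2 := hc2 x hx
    have hy1 := hc1 y hy
    have hy2 := hc2 y hy
    rcases le_abs.1 h with h | h
    · exact le_abs.2 (Or.inl (by linarith))
    · exact le_abs.2 (Or.inr (by linarith))
  set T := (fareyPairs Q).image c with hT
  have hm : ∀ n ∈ T, ∃ m : ℤ, |m - baseSeq N n| ≤ 5 / Q := by
    intro n hn
    obtain ⟨x, hx, rfl⟩ := Finset.mem_image.1 hn
    exact hc4 x hx
  choose! m hm using hm
  have hinj : Set.InjOn c (fareyPairs Q) := by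
    intro x hx y hy hxy
    by_contra hne
    have h := hdist x hx y hy hne
    rw [hxy, sub_self, abs_zero] at h
    linarith
  have hL : 0 < 1000 * (Q : ℝ) := by positivity
  have hsep : ∀ n ∈ T, ∀ k ∈ T, n ≠ k → 6 * (1000 * (Q : ℝ)) + 2 ≤ |(n : ℝ) - k| := by
    intro n hn k hk hnk
    obtain ⟨x, hx, rfl⟩ := Finset.mem_image.1 hn
    obtain ⟨y, hy, rfl⟩ := Finset.mem_image.1 hk
    exact hdist x hx y hy fun h => hnk (by rw [h])
  have herr : ∀ n ∈ T, |m n - baseSeq N n| / (6 * (1000 * (Q : ℝ)) ^ 2) * 8 ≤ 1 / (2 * N) := by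
    intro n hn
    calc |m n - baseSeq N n| / (6 * (1000 * (Q : ℝ)) ^ 2) * 8
        ≤ 5 / Q / (6 * (1000 * (Q : ℝ)) ^ 2) * 8 := by gcongr; exact hm n hn
      _ = 1 / (150000 * (Q : ℝ) ^ 3) := by field_simp; norm_num
      _ ≤ 1 / (2 * N) := by
        apply one_div_le_one_div_of_le (by positivity)
        have : 0 ≤ (Q : ℝ) ^ 3 := by positivity
        linarith
  have hleft : ∀ n ∈ T, 3 * (1000 * (Q : ℝ)) + 2 ≤ n := by
    intro n hn
    obtain ⟨⟨p, q⟩, hx, rfl⟩ := Finset.mem_image.1 hn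
    have h1 := hc1 _ hx
    simp only [fareyPairs, Finset.mem_filter, Finset.mem_product, Finset.mem_Ioc] at hx
    obtain ⟨⟨⟨hp, -⟩, hq, hqQ⟩, -⟩ := hx
    have hp' : (1 : ℝ) ≤ p := by exact_mod_cast hp
    have hq' : (0 : ℝ) < q := by exact_mod_cast hq
    have hqQ' : (q : ℝ) ≤ Q := by exact_mod_cast hqQ
    have h2 : 7000 * (Q : ℝ) ≤ N * (p / q) := by
      rw [mul_div_assoc', le_div_iff₀ hq']
      calc 7000 * (Q : ℝ) * q ≤ 7000 * (Q : ℝ) * (Q * Q) := by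
            gcongr; nlinarith
        _ = 7000 * (Q : ℝ) ^ 3 := by ring
        _ ≤ N * 1 := by linarith
        _ ≤ N * p := by gcongr
    have h3 : (N : ℝ) * (p / q) - 1 ≤ c (p, q) := h1
    linarith
  have hconv := uniformlyConvexSeq_perturbedSeq hN hL hsep herr hleft
  refine ⟨_, hconv, ?_⟩
  rw [hconv.latticeHits_eq, ← Finset.card_image_of_injOn hinj]
  refine Finset.card_le_card fun n hn => mem_hitIndices.2 ⟨?_, m n, ?_⟩
  · obtain ⟨x, hx, rfl⟩ := Finset.mem_image.1 hn
    exact hc3 x hx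
  · simp only [perturbedSeq_apply_mem hL hsep hn]

/-- Subtracting the first term preserves all differences and makes it a hit at 0; this handles small
`N`. -/
lemma exists_uniformlyConvexSeq_one_le {N : ℕ} (hN : 0 < N) :
    ∃ a : ℕ → ℝ, UniformlyConvexSeq N a ∧ 1 ≤ latticeHits N a := by
  have h := uniformlyConvexSeq_perturbedSeq (N := N) (L := 1) (T := ∅) (m := fun _ => 0) hN
    one_pos (by simp) (by simp) (by simp)
  set s : ℕ → ℝ := fun n => perturbedSeq N 1 ∅ (fun _ => 0) n / N
  have h' : UniformlyConvexSeq N fun n => s n - s 1 := by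
    simpa only [UniformlyConvexSeq, sub_sub_sub_cancel_right] using h
  refine ⟨_, h', ?_⟩
  rw [h'.latticeHits_eq, Nat.succ_le_iff, Finset.card_pos]
  exact ⟨1, mem_hitIndices.2 ⟨Finset.mem_Icc.2 ⟨le_rfl, hN⟩, 0, by simp⟩⟩

theorem exists_uniformlyConvexSeq_many_hits {N : ℕ} (hN : 10 ≤ N) :
    ∃ a : ℕ → ℝ, UniformlyConvexSeq N a ∧
      1 / 896000 * (N : ℝ) ^ (2 / 3 : ℝ) ≤ (latticeHits N a : ℝ) := by
  have hN1 : (1 : ℝ) ≤ N := by exact_mod_cast (by omega : 1 ≤ N)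
  -- 56000 = 7000 · 2³ is where Q ≥ 2 becomes available, and 896000 = 16 · 56000.
  rcases lt_or_ge N 56000 with hsmall | hlarge
  · obtain ⟨a, ha, hhit⟩ := exists_uniformlyConvexSeq_one_le (by omega : 0 < N)
    refine ⟨a, ha, ?_⟩
    have h1 : (1 : ℝ) ≤ latticeHits N a := by exact_mod_cast hhit
    have h2 : (N : ℝ) ^ (2 / 3 : ℝ) ≤ N := by
      simpa using Real.rpow_le_rpow_of_exponent_le hN1 (by norm_num : (2 / 3 : ℝ) ≤ 1)
    have h3 : (N : ℝ) < 56000 := by exact_mod_cast hsmall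
    linarith
  · set Q := Nat.findGreatest (fun Q => 7000 * Q ^ 3 ≤ N) N with hQdef
    have hQN : 7000 * Q ^ 3 ≤ N :=
      Nat.findGreatest_spec (P := fun Q => 7000 * Q ^ 3 ≤ N) (m := 0) (by omega) (by simp)
    have hQ2 : 2 ≤ Q :=
      Nat.le_findGreatest (P := fun Q => 7000 * Q ^ 3 ≤ N) (by omega) (by omega)
    have hNlt : N < 7000 * (Q + 1) ^ 3 := by
      by_contra hcon
      have hle : Q + 1 ≤ N := by
        have : Q + 1 ≤ (Q + 1) ^ 3 := Nat.le_self_pow (by norm_num) _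
        omega
      have := Nat.le_findGreatest (P := fun Q => 7000 * Q ^ 3 ≤ N) hle (not_lt.1 hcon)
      omega
    have hNQ : N ≤ 56000 * Q ^ 3 := by
      have : (Q + 1) ^ 3 ≤ (2 * Q) ^ 3 := Nat.pow_le_pow_left (by omega) 3
      rw [mul_pow] at this
      omega
    obtain ⟨a, ha, hhit⟩ := exists_uniformlyConvexSeq_card_fareyPairs_le (by omega) hQN hNQ
    refine ⟨a, ha, ?_⟩
    have h1 := sq_div_le_card_fareyPairs hQ2
    have h2 : ((fareyPairs Q).card : ℝ) ≤ latticeHits N a := by exact_mod_cast hhit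
    have hNQ' : (N : ℝ) ≤ 56000 * (Q : ℝ) ^ 3 := by exact_mod_cast hNQ
    have h3 : (N : ℝ) ^ (2 / 3 : ℝ) ≤ 56000 * (Q : ℝ) ^ 2 := by
      calc (N : ℝ) ^ (2 / 3 : ℝ) ≤ (56000 * (Q : ℝ) ^ 3) ^ (2 / 3 : ℝ) := by gcongr
        _ = (56000 : ℝ) ^ (2 / 3 : ℝ) * (Q : ℝ) ^ 2 := by
          rw [Real.mul_rpow (by norm_num) (by positivity), ← Real.rpow_natCast,
            ← Real.rpow_mul (by positivity), ← Real.rpow_natCast]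
          norm_num
        _ ≤ 56000 * (Q : ℝ) ^ 2 := by
          gcongr
          simpa using Real.rpow_le_rpow_of_exponent_le (by norm_num : (1 : ℝ) ≤ 56000)
            (by norm_num : (2 / 3 : ℝ) ≤ 1)
    linarith

theorem mainTheorem6 :
    (∃ c : ℝ, 0 < c ∧ ∀ N : ℕ, 10 ≤ N →
      ∃ a : ℕ → ℝ, UniformlyConvexSeq N a ∧
        c * (N : ℝ) ^ (2 / 3 : ℝ) ≤ (latticeHits N a : ℝ)) ∧
    (∀ c : ℝ, 0 < c → ∃ C : ℝ, 0 < C ∧ ∀ N : ℕ, 10 ≤ N →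
      ∀ a : ℕ → ℝ, UniformlyConvexSeq N a →
        c * (N : ℝ) ^ (2 / 3 : ℝ) ≤ (latticeHits N a : ℝ) →
        ∃ b : ℕ → ℂ, (∃ n ∈ Finset.Icc 1 N, b n ≠ 0) ∧
          ENNReal.ofReal (C * (N : ℝ) ^ (5 / 6 : ℝ) * l2Norm N b) ≤
            MeasureTheory.eLpNorm (maximalFn N a b) 4
              (MeasureTheory.volume.restrict (Set.Icc (0 : ℝ) ((N : ℝ) ^ 2)))) := by
  refine ⟨⟨1 / 896000, by norm_num, fun N hN => exists_uniformlyConvexSeq_many_hits hN⟩,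
    fun c hc => ⟨Real.sqrt c / 2 * (1 / 40) ^ (1 / 4 : ℝ), by positivity, fun N hN a ha hhits => ?_⟩⟩
  exact exists_coeff_le_eLpNorm_maximalFn hc hN ha hhits
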